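/- For integers $k\ge 2$ and $s>r\ge 1$, let $r_k(s;r)$ be the smallest $n$ such that for every colouring of the $r$-element subsets of an $n$-element set with $k$ colours there is an $s$-element subset all of whose $r$-element subsets have the same colour. For real $x$, let $\operatorname{tower}_1(x)=x$ and $\operatorname{tower}_{r+1}(x)=2^{\operatorname{tower}_r(x)}$ for $r\ge 1$. Let $\alpha=\tfrac16\log_2 1073\simeq 1.678$ (to three decimals, i.e. $|\alpha-1.678|<0.0005$). There is an absolute real constant $\beta$ such that the following two statements hold. (1) For $r=3$ and every integer $k\ge 4$, and for every integer $r\ge 4$ and every integer $k\ge\lfloor 5r/2\rfloor-5$, $$r_k(r+1;r)>\operatorname{tower}_r\left(\frac{\alpha}{2}\left(k-\frac{5r}{2}\right)+\beta\right).$$ (2) For $r=3$ and every integer $k\ge 2$, and for every integer $r\ge 4$ and every integer $k\ge\lfloor 5r/2\rfloor-7$, $$r_k(r+2;r)>\operatorname{tower}_r\left(\alpha\left(k-\frac{5r}{2}\right)+\beta\right).$$ -/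

import Mathlib

/-- The tower functions: `tower 1 x = x` and `tower (r + 1) x = 2 ^ tower r x` for `r ≥ 1`.
(The index `0` carries no meaning.) -/
noncomputable def tower : ℕ → ℝ → ℝ
  | 0, x => x
  | 1, x => x
  | r + 2, x => (2 : ℝ) ^ tower (r + 1) x

/-- The arrow relation `n → (s i)_{i < k} ^ r`: for every colouring `f` with `k` colours of the
`r`-element subsets of an `n`-element set, there are a colour `i` and a subset `S` of size `s i`
all of whose `r`-element subsets have colour `i`. -/
def RamseyArrow (n : ℕ) {k : ℕ} (s : Fin k → ℕ) (r : ℕ) : Prop :=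
  ∀ f : {e : Finset (Fin n) // e.card = r} → Fin k,
    ∃ (i : Fin k) (S : Finset (Fin n)), S.card = s i ∧
      ∀ e : {e : Finset (Fin n) // e.card = r}, e.1 ⊆ S → f e = i

/-- The multicolour hypergraph (diagonal) Ramsey number `r_k(s; r)`: the smallest `n` such that
every `k`-colouring of the `r`-subsets of an `n`-set has a monochromatic subset of size `s`. -/
noncomputable def ramseyNumber (k s r : ℕ) : ℕ :=
  sInf {n : ℕ | RamseyArrow n (fun _ : Fin k => s) r}

/-!
The bounds come from stepping up: write `N ↛ (s)_k^r` for the negated arrow relation. The starting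
point is a family of graph colourings `n ↛ (3)_k^2` with `n ≥ 2 ^ (α k - 6)`, which is stepped up to
triples and then, one uniformity at a time, to `r`-sets; every step exponentiates the number of
points.

*Graphs.* A template on `1, …, 33` turns a sum-free `k`-colouring of `1, …, S` into a sum-free
`(k + 3)`-colouring of `1, …, 33 S` (`HasSchurColouring.mul_template`). Differences give triangle-free
edge colourings, and `33 ^ (1 / 3) > 1073 ^ (1 / 6) = 2 ^ α`.

*Stepping up.* Points `y 0 < y 1 < ⋯` below `2 ^ n` have levels `d i < n`, the highest binary digits
in which `y i` and `y (i + 1)` differ. Deleting a point replaces two adjacent levels by their maximum.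
If the levels form a valley, i.e. have no interior local maximum (peak), they are distinct and each
set of `r` of them is the set of levels of `r + 1` of the points (`Valley.exists_levels_eq`). Hence
colouring an `(r + 1)`-set whose levels form a valley by the given colour of its set of levels excludes
monochromatic sets with valley levels. For `r = 2` this gives `n ↛ (3)_k^2 → 2 ^ n ↛ (5)_k^3`, as four
levels contain a valley of length three (`Avoids.step_graph`), and `2 ^ n ↛ (4)_{2k}^3` if the colours
also record whether the two levels rise or fall (`Avoids.step_graph_double`).

For `r ≥ 3` two extra colours take care of all peaks: `n ↛ (s)_k^r → 2 ^ n ↛ (s + 1)_{k + 2}^{r + 1}`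
(`Avoids.step`). The colour of a non-valley is essentially the parity of the position of its first
peak; deleting the first level changes that parity, deleting the last one does not, and the exceptional
case of a peak at index `1` is treated with the help of an old colour (`exists_peakLabel_ne`).

Going from triples to `r`-sets costs `2 (r - 3)` colours, leaving `k - 2 r + 6 ≥ k - 5 r / 2` of them
for the triples, so that `β = -7` absorbs all constants. Since `ramseyNumber` is an infimum, the bounds
also need that it is attained, i.e. Ramsey's theorem (`ramsey_finset`).
-/

/-! ### Colourings of finite sets of naturals, and Ramsey's theorem -/

/-- The negated arrow relation `N ↛ (s)_k^r`, for the vertex set `range N`. The colouring is a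
total function on finite sets of naturals; only its values on `r`-sets matter. -/
def Avoids (N k s r : ℕ) : Prop :=
  ∃ c : Finset ℕ → ℕ, (∀ e, c e < k) ∧
    ∀ T ⊆ Finset.range N, T.card = s → ∀ i, ∃ e ⊆ T, e.card = r ∧ c e ≠ i

lemma Avoids.mono_colours {N k k' s r : ℕ} (h : Avoids N k s r) (hk : k ≤ k') :
    Avoids N k' s r := by
  obtain ⟨c, hc, h⟩ := h
  exact ⟨c, fun e => (hc e).trans_le hk, h⟩

/-- **Ramsey's theorem** for `r`-sets, in finite form. The induction step first finds a large set
in which the colour of an `(r + 1)`-set depends only on its least element. -/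
theorem ramsey_finset (k r : ℕ) : ∀ s : ℕ, ∃ N : ℕ, ∀ c : Finset ℕ → ℕ, (∀ e, c e < k) →
    ∀ A : Finset ℕ, N ≤ A.card → ∃ T ⊆ A, T.card = s ∧ ∃ i < k, ∀ e ⊆ T, e.card = r → c e = i := by
  induction r with
  | zero =>
    refine fun s => ⟨s, fun c hc A hA => ?_⟩
    obtain ⟨T, hT, hs⟩ := Finset.exists_subset_card_eq hA
    refine ⟨T, hT, hs, c ∅, hc _, fun e _ he => ?_⟩
    rw [Finset.card_eq_zero.1 he]
  | succ r ih =>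
    have key : ∀ m : ℕ, ∃ N : ℕ, ∀ c : Finset ℕ → ℕ, (∀ e, c e < k) →
        ∀ A : Finset ℕ, N ≤ A.card → ∃ T ⊆ A, T.card = m ∧ ∃ g : ℕ → ℕ, (∀ x, g x < k) ∧
          ∀ a ∈ T, ∀ e ⊆ T, e.card = r → (∀ b ∈ e, a < b) → c (insert a e) = g a := by
      intro m
      induction m with
      | zero =>
        refine ⟨0, fun c hc A _ => ⟨∅, by simp, rfl, fun _ => c ∅, fun _ => hc _, by simp⟩⟩
      | succ m ihm =>
        obtain ⟨N₁, hN₁⟩ := ihm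
        obtain ⟨N₂, hN₂⟩ := ih N₁
        refine ⟨N₂ + 1, fun c hc A hA => ?_⟩
        have hne : A.Nonempty := Finset.card_pos.1 (by omega)
        set a := A.min' hne with ha
        have haA : a ∈ A := A.min'_mem hne
        obtain ⟨B, hB, hBc, i, hi, hmono⟩ := hN₂ (fun e => c (insert a e)) (fun e => hc _)
          (A.erase a) (by rw [Finset.card_erase_of_mem haA]; omega)
        obtain ⟨T, hT, hTc, g, hg, hTg⟩ := hN₁ c hc B hBc.ge
        have hlt : ∀ b ∈ T, a < b := fun b hb => A.min'_lt_of_mem_erase_min' hne (hB (hT hb))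
        have haT : a ∉ T := fun h => lt_irrefl _ (hlt a h)
        refine ⟨insert a T, Finset.insert_subset haA
          ((hT.trans hB).trans (Finset.erase_subset _ _)), by simp [haT, hTc],
          Function.update g a i, fun x => ?_, fun b hb e he hec hbe => ?_⟩
        · rcases eq_or_ne x a with rfl | h
          · simpa using hi
          · simpa [h] using hg x
        · rcases Finset.mem_insert.1 hb with rfl | hbT
          · have heT : e ⊆ T := fun x hx => by
              rcases Finset.mem_insert.1 (he hx) with rfl | h
              · exact absurd (hbe _ hx) (lt_irrefl _)
              · exact h
            simpa using hmono e (heT.trans hT) hec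
          · have heT : e ⊆ T := fun x hx => by
              rcases Finset.mem_insert.1 (he hx) with rfl | h
              · exact absurd (hbe _ hx) (hlt b hbT).asymm
              · exact h
            have hba : b ≠ a := fun h => haT (h ▸ hbT)
            simpa [hba] using hTg b hbT e heT hec hbe
    intro s
    obtain ⟨N, hN⟩ := key (k * s)
    refine ⟨N, fun c hc A hA => ?_⟩
    obtain ⟨T, hT, hTc, g, hg, hTg⟩ := hN c hc A hA
    have hk : (Finset.range k).Nonempty := Finset.nonempty_range_iff.2 (hc ∅).ne_bot
    obtain ⟨i, hi, hcard⟩ := Finset.exists_le_card_fiber_of_mul_le_card_of_maps_to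
      (s := T) (t := Finset.range k) (f := g) (n := s) (fun x _ => by simpa using hg x) hk
      (by simp [hTc])
    obtain ⟨S, hS, hSc⟩ := Finset.exists_subset_card_eq hcard
    refine ⟨S, (hS.trans (Finset.filter_subset _ _)).trans hT, hSc, i, by simpa using hi, ?_⟩
    intro e he hec
    have hne : e.Nonempty := Finset.card_pos.1 (by omega)
    have hmem := e.min'_mem hne
    have h1 := hS (he hmem)
    rw [Finset.mem_filter] at h1
    rw [← Finset.insert_erase hmem, hTg _ h1.1 (e.erase (e.min' hne))
      (fun x hx => (Finset.mem_filter.1 (hS (he (Finset.mem_of_mem_erase hx)))).1)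
      (by rw [Finset.card_erase_of_mem hmem]; omega)
      (fun b hb => e.min'_lt_of_mem_erase_min' hne hb), h1.2]

/-- The Ramsey number exists, that is, the infimum in `ramseyNumber` is not the junk value `0` of
an empty set, so that a colouring of `range N` bounds it from below. -/
theorem Avoids.lt_ramseyNumber {N k s r : ℕ} (h : Avoids N k s r) : N < ramseyNumber k s r := by
  have hk : 0 < k := by
    obtain ⟨c, hc, -⟩ := h
    exact (Nat.zero_le _).trans_lt (hc ∅)
  have hne : {n : ℕ | RamseyArrow n (fun _ : Fin k => s) r}.Nonempty := by
    obtain ⟨n, hn⟩ := ramsey_finset k r s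
    refine ⟨n, fun f => ?_⟩
    let p : Finset ℕ → Finset (Fin n) := fun e => Finset.univ.filter (fun x : Fin n => (x : ℕ) ∈ e)
    let c : Finset ℕ → ℕ := fun e => if h : (p e).card = r then f ⟨p e, h⟩ else 0
    obtain ⟨T, hT, hTs, i, hi, hmono⟩ := hn c
      (fun e => by
        by_cases h : (p e).card = r
        · simp [c, h]
        · simpa [c, h] using hk) (Finset.range n) (by simp)
    have hp : ∀ e ⊆ Finset.range n, (p e).map Fin.valEmbedding = e := by
      intro e he
      ext x
      simp only [p, Finset.mem_map, Finset.mem_filter, Finset.mem_univ, true_and,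
        Fin.valEmbedding_apply]
      exact ⟨fun ⟨y, hy, hyx⟩ => hyx ▸ hy, fun hx => ⟨⟨x, Finset.mem_range.1 (he hx)⟩, hx, rfl⟩⟩
    refine ⟨⟨i, hi⟩, p T, by rw [← hTs, ← Finset.card_map Fin.valEmbedding, hp T hT], ?_⟩
    rintro ⟨e, he⟩ heT
    have hpe : p (e.map Fin.valEmbedding) = e := by
      ext x
      simp [p, Fin.val_inj]
    have := hmono (e.map Fin.valEmbedding)
      (by rw [← hp T hT]; exact Finset.map_subset_map.2 heT) (by simpa using he)
    simp only [c, hpe, he, dite_true] at this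
    exact Fin.ext this
  by_contra hlt
  obtain ⟨c, hc, h⟩ := h
  obtain ⟨i, S, hS, hmono⟩ := Nat.sInf_mem hne
    (fun e => ⟨c (e.1.map Fin.valEmbedding), hc _⟩)
  obtain ⟨e, he, hec, hne⟩ := h (S.map Fin.valEmbedding) (fun x hx => by
    obtain ⟨y, -, rfl⟩ := Finset.mem_map.1 hx
    exact Finset.mem_range.2 (y.2.trans_le (not_lt.1 hlt))) (by simpa using hS) i
  obtain ⟨e', he', rfl⟩ := Finset.subset_map_iff.1 he
  exact hne (congrArg Fin.val (hmono ⟨e', by simpa using hec⟩ he'))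

/-! ### The highest binary digit in which two naturals differ -/

lemma exists_div_two_pow_eq (a b : ℕ) : ∃ i, a / 2 ^ (i + 1) = b / 2 ^ (i + 1) := by
  refine ⟨a + b, ?_⟩
  have h : a + b < 2 ^ (a + b + 1) :=
    Nat.lt_two_pow_self.trans (Nat.pow_lt_pow_right one_lt_two (Nat.lt_succ_self _))
  rw [Nat.div_eq_of_lt (by omega), Nat.div_eq_of_lt (by omega)]

/-- The position of the highest binary digit in which `a` and `b` differ (and `0` if `a = b`). -/
def splitLevel (a b : ℕ) : ℕ := Nat.find (exists_div_two_pow_eq a b)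

lemma splitLevel_spec (a b : ℕ) :
    a / 2 ^ (splitLevel a b + 1) = b / 2 ^ (splitLevel a b + 1) :=
  Nat.find_spec (exists_div_two_pow_eq a b)

lemma div_eq_of_splitLevel_lt {a b i : ℕ} (h : splitLevel a b < i) : a / 2 ^ i = b / 2 ^ i := by
  obtain ⟨j, rfl⟩ : ∃ j, i = splitLevel a b + 1 + j := ⟨i - (splitLevel a b + 1), by omega⟩
  rw [pow_add, ← Nat.div_div_eq_div_mul, ← Nat.div_div_eq_div_mul, splitLevel_spec]

lemma div_ne_of_le_splitLevel {a b i : ℕ} (hab : a ≠ b) (h : i ≤ splitLevel a b) :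
    a / 2 ^ i ≠ b / 2 ^ i := by
  rcases i with - | i
  · simpa using hab
  · exact Nat.find_min (exists_div_two_pow_eq a b) h

lemma splitLevel_lt {a b n : ℕ} (hab : a < b) (hb : b < 2 ^ n) : splitLevel a b < n := by
  by_contra h
  refine div_ne_of_le_splitLevel hab.ne (not_lt.1 h) ?_
  rw [Nat.div_eq_of_lt (hab.trans hb), Nat.div_eq_of_lt hb]

/-- Going up from `a` through `b` to `c`, the digit in which `a` and `c` first differ flips only
once, so exactly one of the two steps flips it. -/
lemma splitLevel_of_lt_of_lt {a b c : ℕ} (hab : a < b) (hbc : b < c) :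
    splitLevel a b ≠ splitLevel b c ∧
      splitLevel a c = max (splitLevel a b) (splitLevel b c) := by
  have h1 : ∀ i, splitLevel a c < i → splitLevel a b < i ∧ splitLevel b c < i := by
    intro i hi
    have h := div_eq_of_splitLevel_lt hi
    have h2 : a / 2 ^ i ≤ b / 2 ^ i := Nat.div_le_div_right hab.le
    have h3 : b / 2 ^ i ≤ c / 2 ^ i := Nat.div_le_div_right hbc.le
    constructor <;> by_contra hlt
    · exact div_ne_of_le_splitLevel hab.ne (not_lt.1 hlt) (by omega)
    · exact div_ne_of_le_splitLevel hbc.ne (not_lt.1 hlt) (by omega)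
  constructor
  · intro h
    have e1 := splitLevel_spec a b
    have e2 := splitLevel_spec b c
    have n1 := div_ne_of_le_splitLevel hab.ne le_rfl
    have n2 := div_ne_of_le_splitLevel hbc.ne le_rfl
    rw [← h] at e2 n2
    have l1 : a / 2 ^ splitLevel a b ≤ b / 2 ^ splitLevel a b := Nat.div_le_div_right hab.le
    have l2 : b / 2 ^ splitLevel a b ≤ c / 2 ^ splitLevel a b := Nat.div_le_div_right hbc.le
    rw [pow_succ, ← Nat.div_div_eq_div_mul, ← Nat.div_div_eq_div_mul] at e1 e2
    omega
  · apply le_antisymm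
    · by_contra hlt
      rw [not_le] at hlt
      exact div_ne_of_le_splitLevel (hab.trans hbc).ne le_rfl
        ((div_eq_of_splitLevel_lt ((le_max_left _ _).trans_lt hlt)).trans
          (div_eq_of_splitLevel_lt ((le_max_right _ _).trans_lt hlt)))
    · have := h1 _ (Nat.lt_succ_self _)
      omega

/-! ### The sequence of splitting levels of an increasing sequence -/

/-- The splitting levels of consecutive terms. For an increasing `y` this encodes the shape of the
binary tree spanned by the points `y 0 < y 1 < ⋯`. -/
def levels (y : ℕ → ℕ) (i : ℕ) : ℕ := splitLevel (y i) (y (i + 1))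

/-- The effect on the levels of deleting the `j`-th point: two neighbouring levels are replaced by
their maximum, or an end level is dropped. -/
def deletePoint (j : ℕ) (d : ℕ → ℕ) (i : ℕ) : ℕ :=
  if i + 1 < j then d i else if i + 1 = j then max (d i) (d (i + 1)) else d (i + 1)

/-- The increasing map of `ℕ` that omits the value `j`. -/
def skip (j i : ℕ) : ℕ := if i < j then i else i + 1

lemma strictMono_skip (j : ℕ) : StrictMono (skip j) := by
  intro a b h
  unfold skip
  split_ifs <;> omega

lemma levels_comp_skip {y : ℕ → ℕ} (hy : StrictMono y) (j : ℕ) :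
    levels (y ∘ skip j) = deletePoint j (levels y) := by
  funext i
  unfold levels deletePoint
  rcases lt_trichotomy (i + 1) j with h | h | h
  · have h' : i < j := by omega
    simp [skip, h, h']
  · have h' : i < j := by omega
    simp [skip, h, h']
    subst h
    exact (splitLevel_of_lt_of_lt (hy (Nat.lt_succ_self _)) (hy (Nat.lt_succ_self _))).2
  · have h1 : ¬ i < j := by omega
    have h2 : ¬ i + 1 < j := by omega
    simp [skip, h1, h2, h.ne']

lemma levels_ne {y : ℕ → ℕ} (hy : StrictMono y) (i : ℕ) : levels y i ≠ levels y (i + 1) :=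
  (splitLevel_of_lt_of_lt (hy (Nat.lt_succ_self _)) (hy (Nat.lt_succ_self _))).1

/-- Every interval of levels has a unique maximum, namely at the step that crosses the top split of
the points involved. -/
lemma exists_unique_max_levels {y : ℕ → ℕ} (hy : StrictMono y) (a : ℕ) {b : ℕ} (hab : a ≤ b) :
    ∃ m, a ≤ m ∧ m ≤ b ∧ levels y m = splitLevel (y a) (y (b + 1)) ∧
      ∀ j, a ≤ j → j ≤ b → j ≠ m → levels y j < levels y m := by
  induction b, hab using Nat.le_induction with
  | base => exact ⟨a, le_rfl, le_rfl, rfl, fun j h1 h2 h3 => by omega⟩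
  | succ b hab ih =>
    obtain ⟨m, h1, h2, h3, h4⟩ := ih
    obtain ⟨hne, hmax⟩ := splitLevel_of_lt_of_lt (hy (show a < b + 1 by omega))
      (hy (Nat.lt_succ_self (b + 1)))
    have hd : levels y (b + 1) = splitLevel (y (b + 1)) (y (b + 1).succ) := rfl
    rcases lt_or_gt_of_ne hne with h | h
    · refine ⟨b + 1, by omega, le_rfl, by rw [hmax, hd]; omega, fun j hj1 hj2 hj3 => ?_⟩
      rcases eq_or_ne j m with rfl | hjm
      · omega
      · have := h4 j hj1 (by omega) hjm
        omega
    · refine ⟨m, h1, by omega, by rw [hmax]; omega, fun j hj1 hj2 hj3 => ?_⟩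
      rcases eq_or_ne j (b + 1) with rfl | hjb
      · omega
      · exact h4 j hj1 (by omega) hj3

/-- An interior local maximum at `i` among the first `r` terms of `d`. -/
def IsPeak (r : ℕ) (d : ℕ → ℕ) (i : ℕ) : Prop :=
  0 < i ∧ i + 1 < r ∧ d (i - 1) < d i ∧ d (i + 1) < d i

/-- The first `s` terms of `d` first fall and then rise, in the form inherited by subsequences:
no term lies (weakly) above both an earlier and a later one. -/
def Valley (s : ℕ) (d : ℕ → ℕ) : Prop :=
  ∀ i j l, i < j → j < l → l < s → d j < d i ∨ d j < d l

lemma Valley.not_isPeak {s : ℕ} {d : ℕ → ℕ} (h : Valley s d) (i : ℕ) : ¬ IsPeak s d i := by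
  rintro ⟨h1, h2, h3, h4⟩
  have := h (i - 1) i (i + 1) (by omega) (by omega) h2
  omega

lemma valley_levels {y : ℕ → ℕ} (hy : StrictMono y) {s : ℕ}
    (h : ∀ i, ¬ IsPeak s (levels y) i) : Valley s (levels y) := by
  intro i j l hij hjl hl
  obtain ⟨m, h1, h2, -, h4⟩ := exists_unique_max_levels hy i (hij.trans hjl).le
  have hm : m = i ∨ m = l := by
    by_contra hm
    exact h m ⟨by omega, by omega, h4 _ (by omega) (by omega) (by omega),
      h4 _ (by omega) (by omega) (by omega)⟩
  rcases hm with rfl | rfl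
  · exact Or.inl (h4 j (by omega) (by omega) (by omega))
  · exact Or.inr (h4 j (by omega) (by omega) (by omega))

lemma Valley.injOn_levels {y : ℕ → ℕ} (hy : StrictMono y) {s : ℕ} (h : Valley s (levels y)) :
    Set.InjOn (levels y) (Finset.range s) := by
  have key : ∀ i j, i < j → j < s → levels y i ≠ levels y j := by
    intro i j hij hj heq
    obtain ⟨m, h1, h2, -, h4⟩ := exists_unique_max_levels hy i hij.le
    have hmi : m ≠ i := by
      rintro rfl
      exact (h4 j (by omega) le_rfl (by omega)).ne' heq
    have hmj : m ≠ j := by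
      rintro rfl
      exact (h4 i le_rfl (by omega) (by omega)).ne heq
    have := h i m j (by omega) (by omega) hj
    have := h4 i le_rfl (by omega) (by omega)
    have := h4 j (by omega) le_rfl (by omega)
    omega
  intro i hi j hj heq
  rw [Finset.mem_coe, Finset.mem_range] at hi hj
  rcases lt_trichotomy i j with hij | hij | hij
  · exact absurd heq (key i j hij hj)
  · exact hij
  · exact absurd heq.symm (key j i hij hi)

/-- Deleting a suitable point removes exactly the `t`-th of the levels `d 0, …, d s`, if that is an
end level or lies below one of its neighbours. -/
lemma exists_deletePoint {s : ℕ} {d : ℕ → ℕ} {t : ℕ} (hts : t ≤ s)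
    (ht : t = 0 ∨ t = s ∨ d t < d (t - 1) ∨ d t < d (t + 1)) :
    ∃ j ≤ s + 1, ∀ i < s, deletePoint j d i = d (skip t i) := by
  rcases Nat.eq_zero_or_pos t with rfl | h0
  · exact ⟨0, by omega, fun i _ => by simp [deletePoint, skip]⟩
  rcases eq_or_lt_of_le hts with rfl | hts
  · exact ⟨t + 1, le_rfl, fun i hi => by simp [deletePoint, skip, hi]⟩
  rcases ht with ht | ht | h1 | h1
  · omega
  · omega
  · refine ⟨t, by omega, fun i _ => ?_⟩
    unfold deletePoint skip
    rcases lt_trichotomy (i + 1) t with hi | hi | hi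
    · simp [hi, show i < t by omega]
    · subst hi
      simp at h1
      simp [h1.le]
    · simp [hi.ne', show ¬ i < t by omega, show ¬ i + 1 < t by omega]
  · refine ⟨t + 1, by omega, fun i _ => ?_⟩
    unfold deletePoint skip
    rcases lt_trichotomy i t with hi | hi | hi
    · simp [hi]
    · subst hi
      simp [h1.le]
    · simp [hi.ne', show ¬ i < t by omega]

/-- Every set of levels occurring in a valley is the exact set of levels of some subset of
the points, and that subset is again a valley. -/
lemma Valley.exists_levels_eq {r : ℕ} (s : ℕ) : ∀ {y : ℕ → ℕ}, StrictMono y →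
    Valley s (levels y) → ∀ A ⊆ (Finset.range s).image (levels y), A.card = r →
    ∃ f : ℕ → ℕ, StrictMono f ∧ f r ≤ s ∧
      (Finset.range r).image (levels (y ∘ f)) = A ∧ Valley r (levels (y ∘ f)) := by
  induction s with
  | zero =>
    intro y hy h A hA hr
    obtain rfl : A = ∅ := by simpa using hA
    obtain rfl : r = 0 := by simpa using hr.symm
    exact ⟨id, strictMono_id, le_rfl, rfl, h⟩
  | succ s ih =>
    intro y hy h A hA hr
    by_cases hAeq : A = (Finset.range (s + 1)).image (levels y)
    · have hrs : r = s + 1 := by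
        rw [← hr, hAeq, Finset.card_image_of_injOn (Valley.injOn_levels hy h), Finset.card_range]
      subst hrs
      exact ⟨id, strictMono_id, le_rfl, hAeq.symm, h⟩
    · obtain ⟨x, hx, hxA⟩ := Finset.exists_of_ssubset (hA.ssubset_of_ne hAeq)
      obtain ⟨t, ht, rfl⟩ := Finset.mem_image.1 hx
      rw [Finset.mem_range] at ht
      obtain ⟨j, hj, hdel⟩ := exists_deletePoint (d := levels y) (Nat.le_of_lt_succ ht) (by
        by_contra hc
        have := h (t - 1) t (t + 1) (by omega) (by omega) (by omega)
        omega)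
      have hlev : ∀ i < s, levels (y ∘ skip j) i = levels y (skip t i) := fun i hi => by
        rw [levels_comp_skip hy, hdel i hi]
      have hskip : ∀ i < s, skip t i < s + 1 := fun i hi => by unfold skip; split_ifs <;> omega
      obtain ⟨f, hf, hfr, himg, hval⟩ := ih (hy.comp (strictMono_skip j))
        (fun i i' l h1 h2 h3 => by
          rw [hlev i (by omega), hlev i' (by omega), hlev l h3]
          exact h _ _ _ (strictMono_skip t h1) (strictMono_skip t h2) (hskip l h3)) A
        (fun x hxmem => by
          obtain ⟨i, hi, rfl⟩ := Finset.mem_image.1 (hA hxmem)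
          rw [Finset.mem_range] at hi
          have hit : i ≠ t := by
            rintro rfl
            exact hxA hxmem
          refine Finset.mem_image.2 ⟨if i < t then i else i - 1, Finset.mem_range.2 ?_, ?_⟩
          · split_ifs <;> omega
          · rw [hlev _ (by split_ifs <;> omega)]
            congr 1
            unfold skip
            split_ifs <;> omega) hr
      refine ⟨skip j ∘ f, (strictMono_skip j).comp hf, ?_, himg, hval⟩
      simp only [Function.comp_apply, skip]
      split_ifs <;> omega

/-! ### Colourings of the subsets of `range (2 ^ n)` through their levels -/

lemma exists_strictMono_image_range (T : Finset ℕ) :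
    ∃ y : ℕ → ℕ, StrictMono y ∧ (Finset.range T.card).image y = T := by
  refine ⟨fun i => if h : i < T.card then T.orderEmbOfFin rfl ⟨i, h⟩ else T.sup id + 1 + i,
    fun a b hab => ?_, ?_⟩
  · dsimp only
    split_ifs with h1 h2 h2
    · exact (T.orderEmbOfFin rfl).strictMono hab
    · have : T.orderEmbOfFin rfl ⟨a, h1⟩ ≤ T.sup id :=
        Finset.le_sup (f := id) (T.orderEmbOfFin_mem rfl _)
      omega
    · omega
    · omega
  · ext x
    simp only [Finset.mem_image, Finset.mem_range]
    constructor
    · rintro ⟨i, hi, rfl⟩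
      rw [dif_pos hi]
      exact T.orderEmbOfFin_mem rfl _
    · intro hx
      have : x ∈ Set.range (T.orderEmbOfFin rfl) := by simpa using hx
      obtain ⟨i, rfl⟩ := this
      exact ⟨i, i.2, by simp⟩

/-- An increasing sequence whose first `T.card` terms are the elements of `T`. -/
noncomputable def enumerate (T : Finset ℕ) : ℕ → ℕ := (exists_strictMono_image_range T).choose

lemma strictMono_enumerate (T : Finset ℕ) : StrictMono (enumerate T) :=
  (exists_strictMono_image_range T).choose_spec.1

lemma image_enumerate (T : Finset ℕ) : (Finset.range T.card).image (enumerate T) = T :=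
  (exists_strictMono_image_range T).choose_spec.2

lemma le_of_image_range_eq {n : ℕ} {y z : ℕ → ℕ} (hy : StrictMono y) (hz : StrictMono z)
    (h : (Finset.range n).image y = (Finset.range n).image z) {i : ℕ} (hi : i < n)
    (ih : ∀ j < i, y j = z j) : y i ≤ z i := by
  have : z i ∈ (Finset.range n).image y :=
    h ▸ Finset.mem_image_of_mem _ (Finset.mem_range.2 hi)
  obtain ⟨j, -, hj⟩ := Finset.mem_image.1 this
  rcases lt_or_ge j i with hji | hji
  · have := hz hji
    have := ih j hji
    omega
  · exact hj ▸ hy.monotone hji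

lemma eq_of_image_range_eq {n : ℕ} {y z : ℕ → ℕ} (hy : StrictMono y) (hz : StrictMono z)
    (h : (Finset.range n).image y = (Finset.range n).image z) {i : ℕ} (hi : i < n) :
    y i = z i := by
  induction i using Nat.strong_induction_on with
  | _ i ih =>
    have ih' : ∀ j < i, y j = z j := fun j hj => ih j hj (hj.trans hi)
    exact le_antisymm (le_of_image_range_eq hy hz h hi ih')
      (le_of_image_range_eq hz hy h.symm hi fun j hj => (ih' j hj).symm)

/-- To colour the `(r + 1)`-subsets of `range (2 ^ n)` it suffices to colour level sequences of
length `r`. -/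
lemma avoids_of_levels {n k s r : ℕ} (col : (ℕ → ℕ) → ℕ)
    (hcol : ∀ d d' : ℕ → ℕ, (∀ i < r, d i = d' i) → col d = col d') (hk : ∀ d, col d < k)
    (h : ∀ y : ℕ → ℕ, StrictMono y → y s < 2 ^ n → ∀ i, ∃ f : ℕ → ℕ, StrictMono f ∧ f r ≤ s ∧
      col (levels (y ∘ f)) ≠ i) :
    Avoids (2 ^ n) k (s + 1) (r + 1) := by
  refine ⟨fun e => col (levels (enumerate e)), fun e => hk _, fun T hT hTs i => ?_⟩
  have himg := image_enumerate T
  rw [hTs] at himg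
  have hmem : ∀ j ≤ s, enumerate T j ∈ T := fun j hj => by
    have : enumerate T j ∈ (Finset.range (s + 1)).image (enumerate T) :=
      Finset.mem_image_of_mem _ (Finset.mem_range.2 (by omega))
    rwa [himg] at this
  obtain ⟨f, hf, hfs, hne⟩ := h (enumerate T) (strictMono_enumerate T)
    (Finset.mem_range.1 (hT (hmem s le_rfl))) i
  have hyf : StrictMono (enumerate T ∘ f) := (strictMono_enumerate T).comp hf
  have hcard : ((Finset.range (r + 1)).image (enumerate T ∘ f)).card = r + 1 := by
    rw [Finset.card_image_of_injective _ hyf.injective, Finset.card_range]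
  refine ⟨(Finset.range (r + 1)).image (enumerate T ∘ f), fun x hx => ?_, hcard, ?_⟩
  · obtain ⟨j, hj, rfl⟩ := Finset.mem_image.1 hx
    exact hmem _ ((hf.monotone (Nat.le_of_lt_succ (Finset.mem_range.1 hj))).trans hfs)
  · have heq := image_enumerate ((Finset.range (r + 1)).image (enumerate T ∘ f))
    rw [hcard] at heq
    have hval := fun j hj => eq_of_image_range_eq (i := j) (strictMono_enumerate _) hyf heq hj
    dsimp only
    rw [hcol _ (levels (enumerate T ∘ f)) fun j hj => ?_]
    · exact hne
    · unfold levels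
      rw [hval j (by omega), hval (j + 1) (by omega)]

/-- If the levels of `s + 1` points form a valley, they are an `s`-set all of whose `r`-subsets are
sets of levels of `r + 1` of the points, so a colouring without monochromatic `s`-sets sees two
colours. -/
lemma exists_colour_ne_of_valley {n s r : ℕ} {χ : Finset ℕ → ℕ}
    (hχ : ∀ T ⊆ Finset.range n, T.card = s → ∀ i, ∃ e ⊆ T, e.card = r ∧ χ e ≠ i)
    {y : ℕ → ℕ} (hy : StrictMono y) (hys : y s < 2 ^ n) (hv : Valley s (levels y)) (i : ℕ) :
    ∃ f : ℕ → ℕ, StrictMono f ∧ f r ≤ s ∧ Valley r (levels (y ∘ f)) ∧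
      χ ((Finset.range r).image (levels (y ∘ f))) ≠ i := by
  obtain ⟨A, hA, hAr, hne⟩ := hχ ((Finset.range s).image (levels y))
    (fun x hx => by
      obtain ⟨j, hj, rfl⟩ := Finset.mem_image.1 hx
      exact Finset.mem_range.2 (splitLevel_lt (hy (Nat.lt_succ_self j))
        ((hy.monotone (Nat.succ_le_of_lt (Finset.mem_range.1 hj))).trans_lt hys)))
    (by rw [Finset.card_image_of_injOn (Valley.injOn_levels hy hv), Finset.card_range]) i
  obtain ⟨f, hf, hfs, himg, hval⟩ := Valley.exists_levels_eq s hy hv A hA hAr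
  exact ⟨f, hf, hfs, hval, by rwa [himg]⟩

lemma image_range_congr {r : ℕ} {d d' : ℕ → ℕ} (h : ∀ i < r, d i = d' i) :
    (Finset.range r).image d = (Finset.range r).image d' :=
  Finset.image_congr fun i hi => h i (by simpa using hi)

lemma strictMono_add_right (a : ℕ) : StrictMono (fun i : ℕ => i + a) :=
  fun _ _ h => Nat.add_lt_add_right h a

/-! ### From graphs to triples -/

/-- Among any four consecutive levels three consecutive ones have no peak in the middle, so they
form a valley. -/
theorem Avoids.step_graph {n k : ℕ} (h : Avoids n k 3 2) : Avoids (2 ^ n) k 5 3 := by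
  obtain ⟨χ, hk, hχ⟩ := h
  refine avoids_of_levels (fun d => χ ((Finset.range 2).image d))
    (fun d d' hd => by rw [image_range_congr hd]) (fun d => hk _) fun y hy hys i => ?_
  obtain ⟨a, ha, hpeak⟩ : ∃ a ≤ 1, ∀ j, ¬ IsPeak 3 (levels (y ∘ fun i => i + a)) j := by
    by_contra! hc
    obtain ⟨j, hj1, hj2, hj3, hj4⟩ := hc 0 (by omega)
    obtain ⟨l, hl1, hl2, hl3, hl4⟩ := hc 1 (by omega)
    obtain rfl : j = 1 := by omega
    obtain rfl : l = 1 := by omega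
    simp [levels] at hj3 hj4 hl3 hl4
    omega
  have hya := hy.comp (strictMono_add_right a)
  obtain ⟨f, hf, hfs, -, hne⟩ := exists_colour_ne_of_valley hχ hya
    ((hy.monotone (show 3 + a ≤ 4 by omega)).trans_lt hys) (valley_levels hya hpeak) i
  exact ⟨(fun i => i + a) ∘ f, (strictMono_add_right a).comp hf, by simp; omega, hne⟩

/-- With twice the colours a triple can also record whether its two levels rise or fall; this
excludes a peak already among four points. -/
theorem Avoids.step_graph_double {n k : ℕ} (h : Avoids n k 3 2) : Avoids (2 ^ n) (2 * k) 4 3 := by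
  obtain ⟨χ, hk, hχ⟩ := h
  refine avoids_of_levels
    (fun d => χ ((Finset.range 2).image d) + if d 0 < d 1 then k else 0)
    (fun d d' hd => by
      simp only [image_range_congr hd, hd 0 (by omega), hd 1 (by omega)])
    (fun d => by
      have := hk ((Finset.range 2).image d)
      split_ifs <;> omega) fun y hy hys i => ?_
  by_cases hpeak : ∃ j, IsPeak 3 (levels y) j
  · obtain ⟨j, hj1, hj2, hj3, hj4⟩ := hpeak
    obtain rfl : j = 1 := by omega
    simp at hj3 hj4
    rcases lt_or_ge i k with hik | hik
    · refine ⟨id, strictMono_id, by simp, ?_⟩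
      simp [hj3]
      omega
    · refine ⟨fun i => i + 1, strictMono_add_right 1, by simp, ?_⟩
      have := hk ((Finset.range 2).image (levels (y ∘ fun i => i + 1)))
      have h4 : ¬ levels (y ∘ fun i => i + 1) 0 < levels (y ∘ fun i => i + 1) 1 := hj4.asymm
      simp only [h4, if_false]
      omega
  · obtain ⟨f, hf, hfs, -, hne⟩ := exists_colour_ne_of_valley hχ hy hys
      (valley_levels hy (not_exists.1 hpeak)) (if i < k then i else i - k)
    refine ⟨f, hf, hfs, ?_⟩
    have := hk ((Finset.range 2).image (levels (y ∘ f)))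
    split_ifs at hne ⊢ <;> omega

/-! ### Labelling sequences of levels by their peaks -/

open Classical in
/-- The label of the first `r` terms of a sequence: `3` if there is no peak. If the first peak is
at an index `p ≥ 2`, the label is the parity of `p`. If it is at the least possible index `1`, the
label is `2` or `1` according to whether there is another peak. -/
noncomputable def peakLabel (r : ℕ) (d : ℕ → ℕ) : ℕ :=
  if h : ∃ i, IsPeak r d i then
    if IsPeak r d 1 then if ∃ q, 1 < q ∧ IsPeak r d q then 2 else 1
    else Nat.find h % 2
  else 3

lemma isPeak_congr {r : ℕ} {d d' : ℕ → ℕ} (h : ∀ i < r, d i = d' i) (i : ℕ) :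
    IsPeak r d i ↔ IsPeak r d' i := by
  unfold IsPeak
  refine and_congr_right fun h0 => and_congr_right fun h1 => ?_
  rw [h _ h1, h i (by omega), h (i - 1) (by omega)]

lemma peakLabel_congr {r : ℕ} {d d' : ℕ → ℕ} (h : ∀ i < r, d i = d' i) :
    peakLabel r d = peakLabel r d' := by
  have : IsPeak r d = IsPeak r d' := funext fun i => propext (isPeak_congr h i)
  unfold peakLabel
  rw [this]

open Classical in
lemma peakLabel_eq_three_iff {r : ℕ} {d : ℕ → ℕ} :
    peakLabel r d = 3 ↔ ∀ i, ¬ IsPeak r d i := by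
  unfold peakLabel
  split_ifs with h h1 h2
  · exact ⟨fun h => by omega, fun h' => absurd h1 (h' 1)⟩
  · exact ⟨fun h => by omega, fun h' => absurd h1 (h' 1)⟩
  · have := Nat.mod_lt (Nat.find h) two_pos
    exact ⟨fun h => by omega, fun h' => absurd h (not_exists.2 h')⟩
  · exact ⟨fun _ => not_exists.1 h, fun _ => rfl⟩

lemma peakLabel_eq_two {r : ℕ} {d : ℕ → ℕ} (h1 : IsPeak r d 1) {q : ℕ} (hq : 1 < q)
    (h : IsPeak r d q) : peakLabel r d = 2 := by
  unfold peakLabel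
  rw [dif_pos ⟨1, h1⟩, if_pos h1, if_pos ⟨q, hq, h⟩]

lemma peakLabel_eq_one {r : ℕ} {d : ℕ → ℕ} (h1 : IsPeak r d 1)
    (h : ∀ q, 1 < q → ¬ IsPeak r d q) : peakLabel r d = 1 := by
  unfold peakLabel
  rw [dif_pos ⟨1, h1⟩, if_pos h1, if_neg (by push Not; exact h)]

open Classical in
lemma peakLabel_eq_mod {r : ℕ} {d : ℕ → ℕ} {p : ℕ} (hp : 2 ≤ p) (h : IsPeak r d p)
    (hlt : ∀ i < p, ¬ IsPeak r d i) : peakLabel r d = p % 2 := by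
  unfold peakLabel
  rw [dif_pos ⟨p, h⟩, if_neg (hlt 1 (by omega))]
  congr 1
  exact (Nat.find_eq_iff _).2 ⟨h, hlt⟩

lemma isPeak_skip_zero {r : ℕ} {d : ℕ → ℕ} {i : ℕ} :
    IsPeak r (d ∘ skip 0) i ↔ 0 < i ∧ IsPeak (r + 1) d (i + 1) := by
  simp only [IsPeak, Function.comp_apply, skip, Nat.not_lt_zero, if_false]
  constructor
  · rintro ⟨h0, h1, h2, h3⟩
    refine ⟨h0, by omega, by omega, ?_, h3⟩
    rwa [show i + 1 - 1 = i - 1 + 1 by omega]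
  · rintro ⟨h0, -, h1, h2, h3⟩
    refine ⟨h0, by omega, ?_, h3⟩
    rwa [show i + 1 - 1 = i - 1 + 1 by omega] at h2

lemma isPeak_skip_last {r : ℕ} {d : ℕ → ℕ} {i : ℕ} :
    IsPeak r (d ∘ skip r) i ↔ i + 1 < r ∧ IsPeak (r + 1) d i := by
  rw [isPeak_congr (d' := d) fun i hi => by simp [skip, hi]]
  unfold IsPeak
  constructor
  · rintro ⟨h0, h1, h2⟩
    exact ⟨h1, h0, by omega, h2⟩
  · rintro ⟨h1, h0, -, h2⟩
    exact ⟨h0, h1, h2⟩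

/-- Deleting a suitable level strictly between a peak at index `1` and the next one keeps both peaks
if they are at least three apart. -/
lemma exists_peakLabel_skip_eq_two {r : ℕ} {d : ℕ → ℕ} (hd : ∀ i, d i ≠ d (i + 1))
    (h1 : IsPeak (r + 1) d 1) {q : ℕ} (hq : 4 ≤ q) (h : IsPeak (r + 1) d q)
    (h3 : ¬ IsPeak (r + 1) d 3) :
    ∃ t ≤ r, (d t < d (t - 1) ∨ d t < d (t + 1)) ∧ peakLabel r (d ∘ skip t) = 2 := by
  obtain ⟨-, -, a1, a2⟩ := h1
  obtain ⟨b0, b1, b2, b3⟩ := h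
  simp only [Nat.sub_self, Nat.reduceAdd] at a1 a2
  have key : ∀ t, 2 ≤ t → t < q → (d ∘ skip t) 2 < d 1 →
      (d ∘ skip t) (q - 2) < d q → peakLabel r (d ∘ skip t) = 2 := by
    intro t ht htq h2 h3
    refine peakLabel_eq_two (q := q - 1) ⟨one_pos, by omega, ?_, ?_⟩ (by omega)
      ⟨by omega, by omega, ?_, ?_⟩
    · simpa [skip, show 0 < t by omega, show 1 < t by omega] using a1
    · rwa [show (d ∘ skip t) 1 = d 1 by simp [skip, show 1 < t by omega]]
    · have : (d ∘ skip t) (q - 1) = d q := by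
        simp [skip, show ¬ q - 1 < t by omega, show q - 1 + 1 = q by omega]
      rw [this]
      exact h3
    · have : (d ∘ skip t) (q - 1) = d q := by
        simp [skip, show ¬ q - 1 < t by omega, show q - 1 + 1 = q by omega]
      rw [this]
      simpa [skip, show q - 1 + 1 = q by omega, show ¬ q < t by omega] using b3
  have hne := hd 2
  simp only [Nat.reduceAdd] at hne
  rcases lt_or_gt_of_ne hne with hlt | hgt
  · rcases lt_or_gt_of_ne (hd 3) with h34 | h34
    · refine ⟨3, by omega, Or.inr h34, key 3 (by omega) (by omega) (by simpa [skip] using a2) ?_⟩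
      rcases eq_or_lt_of_le hq with rfl | hq
      · simpa [skip] using hlt.trans h34
      · simpa [skip, show ¬ q - 2 < 3 by omega, show q - 2 + 1 = q - 1 by omega] using b2
    · exact absurd ⟨by omega, by omega, hlt, h34⟩ h3
  · refine ⟨2, by omega, Or.inl (by simpa using a2), key 2 le_rfl (by omega)
      (by simpa [skip] using hgt.trans a2) ?_⟩
    simpa [skip, show ¬ q - 2 < 2 by omega, show q - 2 + 1 = q - 1 by omega] using b2

/-- If a sequence of `r + 1` levels has a peak, two deletions of a level lead to different labels,
the first of which is `0` or `1`. -/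
theorem exists_peakLabel_ne {r : ℕ} (hr : 3 ≤ r) {d : ℕ → ℕ} (hd : ∀ i, d i ≠ d (i + 1))
    (hp : ∃ i, IsPeak (r + 1) d i) :
    ∃ t ≤ r, ∃ u ≤ r, (t = 0 ∨ t = r ∨ d t < d (t - 1) ∨ d t < d (t + 1)) ∧
      (u = 0 ∨ u = r ∨ d u < d (u - 1) ∨ d u < d (u + 1)) ∧
      peakLabel r (d ∘ skip t) < 2 ∧ peakLabel r (d ∘ skip t) ≠ peakLabel r (d ∘ skip u) := by
  classical
  obtain ⟨p, hp, hmin⟩ : ∃ p, IsPeak (r + 1) d p ∧ ∀ i < p, ¬ IsPeak (r + 1) d i :=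
    ⟨Nat.find hp, Nat.find_spec hp, fun i hi => Nat.find_min hp hi⟩
  obtain ⟨hp0, hpr, -, -⟩ := id hp
  -- A peak beyond index `1` survives the removal of the last level or was the only one.
  have hlast : 2 ≤ p → peakLabel r (d ∘ skip r) = p % 2 ∨
      peakLabel r (d ∘ skip r) = 3 ∧ p + 1 = r := by
    intro h2
    rcases lt_or_ge (p + 1) r with h | h
    · exact Or.inl (peakLabel_eq_mod h2 (isPeak_skip_last.2 ⟨h, hp⟩)
        fun i hi hi' => hmin i hi (isPeak_skip_last.1 hi').2)
    · refine Or.inr ⟨peakLabel_eq_three_iff.2 fun i hi => ?_, by omega⟩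
      rw [isPeak_skip_last] at hi
      exact hmin i (by omega) hi.2
  have hfirst : ∀ q, 3 ≤ q → IsPeak (r + 1) d q → (∀ i, 2 ≤ i → i < q → ¬ IsPeak (r + 1) d i) →
      peakLabel r (d ∘ skip 0) = (q - 1) % 2 := by
    intro q hq hpq hq'
    refine peakLabel_eq_mod (by omega) (isPeak_skip_zero.2 ⟨by omega, ?_⟩) fun i hi hi' => ?_
    · rwa [show q - 1 + 1 = q by omega]
    · rw [isPeak_skip_zero] at hi'
      exact hq' (i + 1) (by omega) (by omega) hi'.2
  obtain h3 | rfl | rfl : 3 ≤ p ∨ p = 2 ∨ p = 1 := by omega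
  · have h0 := hfirst p h3 hp fun i _ hi => hmin i hi
    exact ⟨0, by omega, r, le_rfl, Or.inl rfl, Or.inr (Or.inl rfl), by omega,
      by have := hlast (by omega); omega⟩
  · have h1 : IsPeak r (d ∘ skip 0) 1 := isPeak_skip_zero.2 ⟨one_pos, hp⟩
    by_cases hq : ∃ q, 1 < q ∧ IsPeak r (d ∘ skip 0) q
    · obtain ⟨q, hq1, hq⟩ := hq
      have h0 := peakLabel_eq_two h1 hq1 hq
      have hq2 : q + 1 < r := hq.2.1
      exact ⟨r, le_rfl, 0, by omega, Or.inr (Or.inl rfl), Or.inl rfl,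
        by have := hlast le_rfl; omega, by have := hlast le_rfl; omega⟩
    · push Not at hq
      have h0 := peakLabel_eq_one h1 hq
      exact ⟨0, by omega, r, le_rfl, Or.inl rfl, Or.inr (Or.inl rfl), by omega,
        by have := hlast le_rfl; omega⟩
  · have hr1 : IsPeak r (d ∘ skip r) 1 := isPeak_skip_last.2 ⟨by omega, hp⟩
    by_cases hq : ∃ q, 1 < q ∧ IsPeak (r + 1) d q
    · obtain ⟨q, ⟨hq1, hq⟩, hqmin⟩ : ∃ q, (1 < q ∧ IsPeak (r + 1) d q) ∧
          ∀ i < q, ¬ (1 < i ∧ IsPeak (r + 1) d i) :=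
        ⟨Nat.find hq, Nat.find_spec hq, fun i hi => Nat.find_min hq hi⟩
      have hq3 : 3 ≤ q := by
        -- Two peaks cannot be adjacent.
        by_contra h
        obtain rfl : q = 2 := by omega
        exact hp.2.2.2.asymm hq.2.2.1
      have h0 := hfirst q hq3 hq fun i hi hiq h => hqmin i hiq ⟨hi, h⟩
      by_cases hlast : ∃ i, 1 < i ∧ IsPeak r (d ∘ skip r) i
      · obtain ⟨i, hi, hi'⟩ := hlast
        have h2 := peakLabel_eq_two hr1 hi hi'
        exact ⟨0, by omega, r, le_rfl, Or.inl rfl, Or.inr (Or.inl rfl), by omega, by omega⟩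
      · -- The second peak is at the last possible index `r - 1`, hence lost with the last level.
        push Not at hlast
        have h1 := peakLabel_eq_one hr1 hlast
        rcases Nat.mod_two_eq_zero_or_one (q - 1) with h | h
        · exact ⟨0, by omega, r, le_rfl, Or.inl rfl, Or.inr (Or.inl rfl), by omega, by omega⟩
        · obtain ⟨t, ht, htd, h2⟩ := exists_peakLabel_skip_eq_two hd hp (by omega) hq
            fun h' => hqmin 3 (by omega) ⟨by omega, h'⟩
          exact ⟨0, by omega, t, ht, Or.inl rfl, Or.inr (Or.inr htd), by omega, by omega⟩
    · push Not at hq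
      have h1 := peakLabel_eq_one hr1 fun q hq1 hq' => hq q hq1 (isPeak_skip_last.1 hq').2
      have h3 : peakLabel r (d ∘ skip 0) = 3 := peakLabel_eq_three_iff.2 fun i hi => by
        rw [isPeak_skip_zero] at hi
        exact hq (i + 1) (by omega) hi.2
      exact ⟨r, le_rfl, 0, by omega, Or.inr (Or.inl rfl), Or.inl rfl, by omega, by omega⟩

/-! ### Stepping up from `r`-sets to `(r + 1)`-sets -/

/-- Stepping up with two new colours. Valleys are coloured through the given colouring, and the
labels `0`, `1` get the two new colours. The label `2` reuses the old colour `0`: an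
`(s + 1)`-set whose levels have a peak has an `(r + 1)`-subset of label `0` or `1`, so no set that is
monochromatic in an old colour involves the label `2`. -/
theorem Avoids.step {n k s r : ℕ} (hr : 3 ≤ r) (hs : r + 1 ≤ s) (h : Avoids n k s r) :
    Avoids (2 ^ n) (k + 2) (s + 1) (r + 1) := by
  obtain ⟨χ, hk, hχ⟩ := h
  let col : (ℕ → ℕ) → ℕ := fun d =>
    if peakLabel r d < 2 then k + peakLabel r d
    else if peakLabel r d = 3 then χ ((Finset.range r).image d) else 0
  have hcol : ∀ d d' : ℕ → ℕ, (∀ i < r, d i = d' i) → col d = col d' := fun d d' hd => by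
    simp only [col, peakLabel_congr hd, image_range_congr hd]
  refine avoids_of_levels col hcol (fun d => ?_) fun y hy hys i => ?_
  · have := hk ((Finset.range r).image d)
    simp only [col]
    split_ifs <;> omega
  by_cases hpeak : ∃ p, IsPeak s (levels y) p
  · obtain ⟨p, hp0, hps, hp1, hp2⟩ := hpeak
    -- A window of `r + 1` consecutive levels around the peak.
    obtain ⟨a, ha1, ha2, ha3⟩ : ∃ a, a < p ∧ p + 1 < a + (r + 1) ∧ a + (r + 1) ≤ s := by
      rcases le_total (p - 1) (s - (r + 1)) with h | h
      · exact ⟨p - 1, by omega, by omega, by omega⟩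
      · exact ⟨s - (r + 1), by omega, by omega, by omega⟩
    have hya := hy.comp (strictMono_add_right a)
    have hlev : ∀ j, levels (y ∘ fun i => i + a) j = levels y (j + a) := fun j => by
      simp [levels, show j + 1 + a = j + a + 1 by omega]
    obtain ⟨t, htr, u, hur, ht, hu, hlt, hne⟩ := exists_peakLabel_ne hr (levels_ne hya)
      ⟨p - a, by omega, by omega, by
        rw [hlev, hlev, show p - a - 1 + a = p - 1 by omega, show p - a + a = p by omega]
        exact hp1, by
        rw [hlev, hlev, show p - a + 1 + a = p + 1 by omega, show p - a + a = p by omega]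
        exact hp2⟩
    have hdel : ∀ v ≤ r, (v = 0 ∨ v = r ∨
        levels (y ∘ fun i => i + a) v < levels (y ∘ fun i => i + a) (v - 1) ∨
        levels (y ∘ fun i => i + a) v < levels (y ∘ fun i => i + a) (v + 1)) →
        ∃ f : ℕ → ℕ, StrictMono f ∧ f r ≤ s ∧
          col (levels (y ∘ f)) = col (levels (y ∘ fun i => i + a) ∘ skip v) := by
      intro v hvr hv
      obtain ⟨j, -, hj⟩ := exists_deletePoint hvr hv
      refine ⟨(fun i => i + a) ∘ skip j, (strictMono_add_right a).comp (strictMono_skip j), ?_,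
        hcol _ _ fun i hi => ?_⟩
      · simp only [Function.comp_apply, skip]
        split_ifs <;> omega
      · rw [← Function.comp_assoc, levels_comp_skip hya, hj i hi, Function.comp_apply]
    obtain ⟨f, hf, hfs, hft⟩ := hdel t htr ht
    obtain ⟨g, hg, hgs, hgu⟩ := hdel u hur hu
    have hcolne : col (levels (y ∘ f)) ≠ col (levels (y ∘ g)) := by
      have := hk ((Finset.range r).image (levels (y ∘ fun i => i + a) ∘ skip u))
      rw [hft, hgu]
      simp only [col, hlt, if_true]
      split_ifs <;> omega
    by_cases hi : col (levels (y ∘ f)) = i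
    · exact ⟨g, hg, hgs, fun h => hcolne (hi.trans h.symm)⟩
    · exact ⟨f, hf, hfs, hi⟩
  · obtain ⟨f, hf, hfs, hv, hne⟩ := exists_colour_ne_of_valley hχ hy hys
      (valley_levels hy (not_exists.1 hpeak)) i
    refine ⟨f, hf, hfs, ?_⟩
    simpa [col, peakLabel_eq_three_iff.2 hv.not_isPeak] using hne

/-! ### Graphs without monochromatic triangles from sum-free colourings -/

/-- There is a `k`-colouring of `1, …, S` without monochromatic solutions of `x + y = z`. The
colouring is a total function on the naturals; only its values on `1, …, S` matter. -/
def HasSchurColouring (S k : ℕ) : Prop :=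
  ∃ g : ℕ → ℕ, (∀ x, g x < k) ∧
    ∀ x y, 0 < x → 0 < y → x + y ≤ S → ¬ (g x = g (x + y) ∧ g y = g (x + y))

/-- A colouring of `1, …, 33`, shifted to the indices `0, …, 32`: the classes `0`, `1`, `2` are
sum-free modulo `33`, and the class `3` is sum-free as a set of integers. -/
def schurTemplate (i : ℕ) : ℕ :=
  [1, 2, 0, 0, 2, 1, 3, 3, 1, 0, 0, 0, 1, 2, 2, 1, 3, 3, 3, 1, 3, 3, 3, 1, 2, 2, 1, 0, 0, 0, 1, 3,
    3].getD i 3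

lemma schurTemplate_spec : ∀ i < 33, ∀ j < 33,
    if i + j + 1 < 33 then ¬ (schurTemplate i = schurTemplate (i + j + 1) ∧
      schurTemplate j = schurTemplate (i + j + 1))
    else schurTemplate i = schurTemplate (i + j + 1 - 33) →
      schurTemplate j = schurTemplate (i + j + 1 - 33) → schurTemplate i = 3 := by
  decide +kernel

/-- Cut `1, …, 33 S` into `S` blocks of length `33` and colour each by the template, except that an
element of class `3` receives the colour of the index of its block. -/
lemma HasSchurColouring.mul_template {S k : ℕ} (h : HasSchurColouring S k) :
    HasSchurColouring (33 * S) (k + 3) := by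
  obtain ⟨g, hg, hsum⟩ := h
  refine ⟨fun x => if schurTemplate ((x - 1) % 33) < 3 then schurTemplate ((x - 1) % 33)
    else 3 + g ((x - 1) / 33 + 1), fun x => ?_, fun x y hx hy hxy => ?_⟩
  · have := hg ((x - 1) / 33 + 1)
    dsimp only
    split_ifs <;> omega
  · rintro ⟨h1, h2⟩
    dsimp only at h1 h2
    have hspec := schurTemplate_spec ((x - 1) % 33) (Nat.mod_lt _ (by omega)) ((y - 1) % 33)
      (Nat.mod_lt _ (by omega))
    have hle : ∀ i < 33, schurTemplate i ≤ 3 := by decide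
    have lx := hle _ (Nat.mod_lt (x - 1) (by omega : 0 < 33))
    have ly := hle _ (Nat.mod_lt (y - 1) (by omega : 0 < 33))
    have lz := hle _ (Nat.mod_lt (x + y - 1) (by omega : 0 < 33))
    have ex : schurTemplate ((x - 1) % 33) = schurTemplate ((x + y - 1) % 33) := by
      split_ifs at h1 <;> omega
    have ey : schurTemplate ((y - 1) % 33) = schurTemplate ((x + y - 1) % 33) := by
      split_ifs at h2 <;> omega
    split_ifs at hspec with hlt
    · rw [show (x - 1) % 33 + (y - 1) % 33 + 1 = (x + y - 1) % 33 by omega] at hspec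
      exact hspec ⟨ex, ey⟩
    · rw [show (x - 1) % 33 + (y - 1) % 33 + 1 - 33 = (x + y - 1) % 33 by omega] at hspec
      have h3 := hspec ex ey
      rw [← ex, h3, if_neg (by omega), if_neg (by omega),
        show (x + y - 1) / 33 + 1 = ((x - 1) / 33 + 1) + ((y - 1) / 33 + 1) by omega] at h1
      rw [← ex, ey.trans ex.symm, h3, if_neg (by omega), if_neg (by omega),
        show (x + y - 1) / 33 + 1 = ((x - 1) / 33 + 1) + ((y - 1) / 33 + 1) by omega] at h2
      exact hsum ((x - 1) / 33 + 1) ((y - 1) / 33 + 1) (by omega) (by omega) (by omega)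
        ⟨by omega, by omega⟩

lemma hasSchurColouring_pow (i : ℕ) : HasSchurColouring (33 ^ i) (3 * i + 1) := by
  induction i with
  | zero => exact ⟨fun _ => 0, fun _ => one_pos, fun x y hx hy hxy => by omega⟩
  | succ i ih =>
    rw [pow_succ', show 3 * (i + 1) + 1 = 3 * i + 1 + 3 by ring]
    exact ih.mul_template

/-- Colour an edge by the colour of the difference of its ends. -/
lemma HasSchurColouring.avoids {S k : ℕ} (h : HasSchurColouring S k) : Avoids (S + 1) k 3 2 := by
  obtain ⟨g, hg, hsum⟩ := h
  -- For a pair `e = {a, b}` with `a < b` the argument of `g` is `2 b - (a + b)`.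
  refine ⟨fun e => g (2 * e.sup id - ∑ x ∈ e, x), fun e => hg _, fun T hT hT3 i => ?_⟩
  obtain ⟨y, hy, himg⟩ := exists_strictMono_image_range T
  rw [hT3] at himg
  have hmem : ∀ j < 3, y j ∈ T := fun j hj => by
    have := Finset.mem_image_of_mem y (Finset.mem_range.2 hj)
    rwa [himg] at this
  have h2 := Finset.mem_range.1 (hT (hmem 2 (by omega)))
  have h01 := hy (show 0 < 1 by omega)
  have h12 := hy (show 1 < 2 by omega)
  have hpair : ∀ a b, a < b → 2 * ({a, b} : Finset ℕ).sup id - ∑ x ∈ ({a, b} : Finset ℕ), x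
      = b - a := fun a b hab => by
    rw [Finset.sum_pair hab.ne]
    simp [hab.le]
    omega
  by_contra! hc
  have key : ∀ a < 3, ∀ b < 3, y a < y b → g (y b - y a) = i := fun a ha b hb hab => by
    rw [← hpair _ _ hab]
    refine hc {y a, y b} (fun x hx => ?_) (Finset.card_pair hab.ne)
    rcases Finset.mem_insert.1 hx with rfl | hx
    · exact hmem a ha
    · rw [Finset.mem_singleton.1 hx]
      exact hmem b hb
  refine hsum (y 1 - y 0) (y 2 - y 1) (by omega) (by omega) (by omega) ?_
  rw [show y 1 - y 0 + (y 2 - y 1) = y 2 - y 0 by omega, key 0 (by omega) 2 (by omega) (by omega),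
    key 0 (by omega) 1 (by omega) h01, key 1 (by omega) 2 (by omega) h12]
  exact ⟨rfl, rfl⟩

/-! ### Growth rates -/

lemma tower_mono (r : ℕ) {x y : ℝ} (h : x ≤ y) : tower r x ≤ tower r y := by
  induction r with
  | zero => exact h
  | succ r ih =>
    rcases r with - | r
    · exact h
    · exact Real.rpow_le_rpow_of_exponent_le one_le_two ih

/-- The growth rate `33 ^ (1 / 3)` of the template construction exceeds `1073 ^ (1 / 6)`, because
`1073 < 33 ^ 2`. -/
lemma exists_avoids_triangle {k : ℕ} (hk : 1 ≤ k) :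
    ∃ n, Avoids n k 3 2 ∧ (2 : ℝ) ^ (Real.logb 2 1073 / 6 * k - 6) ≤ n := by
  refine ⟨33 ^ ((k - 1) / 3) + 1,
    (hasSchurColouring_pow _).avoids.mono_colours (by omega), ?_⟩
  set i := (k - 1) / 3 with hi
  have hki : (k : ℝ) ≤ 3 * i + 3 := by
    have : k ≤ 3 * i + 3 := by omega
    exact_mod_cast this
  have h33 : Real.logb 2 1073 ≤ 2 * Real.logb 2 33 := by
    rw [show (2 : ℝ) * Real.logb 2 33 = Real.logb 2 (33 ^ 2) by rw [Real.logb_pow]; norm_num]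
    exact Real.logb_le_logb_of_le one_lt_two (by norm_num) (by norm_num)
  have h11 : Real.logb 2 1073 ≤ 11 := by
    rw [Real.logb_le_iff_le_rpow one_lt_two (by norm_num)]
    norm_num
  have h0 : 0 ≤ Real.logb 2 1073 := Real.logb_nonneg one_lt_two (by norm_num)
  have hexp : Real.logb 2 1073 / 6 * k - 6 ≤ Real.logb 2 33 * i := by
    have h1 : Real.logb 2 1073 / 6 * k ≤ Real.logb 2 1073 / 6 * (3 * i + 3) :=
      mul_le_mul_of_nonneg_left hki (by linarith)
    have h2 : Real.logb 2 1073 * i ≤ 2 * Real.logb 2 33 * i :=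
      mul_le_mul_of_nonneg_right h33 (Nat.cast_nonneg i)
    linarith
  calc (2 : ℝ) ^ (Real.logb 2 1073 / 6 * k - 6)
      ≤ 2 ^ (Real.logb 2 33 * i) := Real.rpow_le_rpow_of_exponent_le one_le_two hexp
    _ = 33 ^ i := by
        rw [Real.rpow_mul zero_le_two, Real.rpow_logb two_pos (by norm_num) (by norm_num),
          Real.rpow_natCast]
    _ ≤ ((33 ^ i + 1 : ℕ) : ℝ) := by push_cast; linarith

/-- Iterated stepping up, starting from triples. -/
lemma exists_avoids_tower {N k s : ℕ} {x : ℝ} (hs : 4 ≤ s) (h : Avoids N k s 3)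
    (hx : tower 3 x ≤ N) (t : ℕ) :
    ∃ M : ℕ, Avoids M (k + 2 * t) (s + t) (3 + t) ∧ tower (3 + t) x ≤ M := by
  induction t with
  | zero => exact ⟨N, h, hx⟩
  | succ t ih =>
    obtain ⟨M, hM, hle⟩ := ih
    refine ⟨2 ^ M, hM.step (r := 3 + t) (s := s + t) (by omega) (by omega), ?_⟩
    have : tower (3 + (t + 1)) x = (2 : ℝ) ^ tower (3 + t) x := by
      rw [show 3 + t = 2 + t + 1 by ring, show 3 + (t + 1) = 2 + t + 2 by ring]
      rfl
    rw [this]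
    push_cast
    rw [← Real.rpow_natCast]
    exact Real.rpow_le_rpow_of_exponent_le one_le_two hle

lemma tower_lt_ramseyNumber {N k r m : ℕ} {x x' : ℝ} (hm : 1 ≤ m) (hr : 3 ≤ r)
    (hk : 2 * (r - 3) ≤ k) (h : Avoids N (k - 2 * (r - 3)) (3 + m) 3) (hx : tower 3 x ≤ N)
    (hx' : x' ≤ x) : tower r x' < ramseyNumber k (r + m) r := by
  obtain ⟨t, rfl⟩ := Nat.exists_eq_add_of_le hr
  obtain ⟨M, hM, hle⟩ := exists_avoids_tower (by omega) h hx t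
  rw [show k - 2 * (3 + t - 3) + 2 * t = k by omega, show 3 + m + t = 3 + t + m by omega] at hM
  exact (tower_mono _ hx').trans_lt (hle.trans_lt (by exact_mod_cast hM.lt_ramseyNumber))

lemma tower_three_le {n : ℕ} {x : ℝ} (h : (2 : ℝ) ^ x ≤ n) : tower 3 x ≤ ((2 ^ n : ℕ) : ℝ) := by
  push_cast
  rw [← Real.rpow_natCast]
  exact Real.rpow_le_rpow_of_exponent_le one_le_two h

theorem corollary2 :
    ∃ α β : ℝ, α = Real.logb 2 1073 / 6 ∧ |α - 1.678| < 0.0005 ∧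
      (∀ r k : ℕ, (r = 3 ∧ 4 ≤ k) ∨ (4 ≤ r ∧ 5 * r / 2 - 5 ≤ k) →
        (ramseyNumber k (r + 1) r : ℝ) > tower r (α / 2 * ((k : ℝ) - 5 * (r : ℝ) / 2) + β)) ∧
      (∀ r k : ℕ, (r = 3 ∧ 2 ≤ k) ∨ (4 ≤ r ∧ 5 * r / 2 - 7 ≤ k) →
        (ramseyNumber k (r + 2) r : ℝ) > tower r (α * ((k : ℝ) - 5 * (r : ℝ) / 2) + β)) := by
  -- `2 ^ 151 < 1073 ^ 15` and `1073 ^ 29 < 2 ^ 292` pin `α` down to the required accuracy.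
  have hlo : 151 / 15 < Real.logb 2 1073 := by
    have : (151 : ℝ) < 15 * Real.logb 2 1073 := by
      rw [show (15 : ℝ) * Real.logb 2 1073 = Real.logb 2 (1073 ^ 15) by
        rw [Real.logb_pow]; norm_num, Real.lt_logb_iff_rpow_lt one_lt_two (by norm_num)]
      norm_num
    linarith
  have hhi : Real.logb 2 1073 < 292 / 29 := by
    have : 29 * Real.logb 2 1073 < (292 : ℝ) := by
      rw [show (29 : ℝ) * Real.logb 2 1073 = Real.logb 2 (1073 ^ 29) by
        rw [Real.logb_pow]; norm_num, Real.logb_lt_iff_lt_rpow one_lt_two (by norm_num),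
        show (292 : ℝ) = (146 : ℕ) + (146 : ℕ) by norm_num, Real.rpow_add two_pos,
        Real.rpow_natCast]
      norm_num
    linarith
  refine ⟨Real.logb 2 1073 / 6, -7, rfl, by rw [abs_lt]; constructor <;> linarith, ?_, ?_⟩
  all_goals
    intro r k hrk
    have hr : 3 ≤ r := by omega
    have hk : 2 * (r - 3) + 1 ≤ k := by omega
    have hcast : ((k - 2 * (r - 3) : ℕ) : ℝ) = k - 2 * r + 6 := by
      rw [Nat.cast_sub (by omega), Nat.cast_mul, Nat.cast_sub hr]
      push_cast
      ring
    have hrpos : (0 : ℝ) ≤ r := Nat.cast_nonneg r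
    set α := Real.logb 2 1073 / 6 with hα
    have hα0 : 0 ≤ α := by linarith
    have hα2 : α ≤ 2 := by linarith
  · obtain ⟨n, hn, hle⟩ := exists_avoids_triangle (k := (k - 2 * (r - 3)) / 2) (by omega)
    refine tower_lt_ramseyNumber le_rfl hr (by omega)
      (hn.step_graph_double.mono_colours (by omega)) (tower_three_le hle) ?_
    have hj : (k : ℝ) - 2 * r + 6 ≤ 2 * ((k - 2 * (r - 3)) / 2 : ℕ) + 1 := by
      rw [← hcast]
      have : k - 2 * (r - 3) ≤ 2 * ((k - 2 * (r - 3)) / 2) + 1 := by omega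
      exact_mod_cast this
    nlinarith
  · obtain ⟨n, hn, hle⟩ := exists_avoids_triangle (k := k - 2 * (r - 3)) (by omega)
    refine tower_lt_ramseyNumber one_le_two hr (by omega) hn.step_graph (tower_three_le hle) ?_
    rw [hcast]
    nlinarith
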